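/- Let $K$ be a field of characteristic $0$, let $n\ge 2$, and for $C\in K[x_1,\dots,x_{n+1}]$ let $P_C$ be the polynomial algebra $K[x_1,\dots,x_{n+1}]$ with the $n$-ary bracket $\{a_1,\dots,a_n\}=J(a_1,\dots,a_n,C)$, where $J(f_1,\dots,f_{n+1})=\det[\partial f_i/\partial x_j]$. For every $\lambda\in K$ the ideal $(C-\lambda)$ is stable under this bracket, which therefore induces a bracket on $S_C=P_C/(C-\lambda)$. A polynomial $g$ is called closed if $K[g]$ is integrally closed in $K[x_1,\dots,x_{n+1}]$. An $n$-ary $K$-multilinear skew-symmetric bracket on a commutative associative $K$-algebra $A$ makes $A$ an $n$-Lie-Poisson algebra if it satisfies the Leibniz identity in each argument and $$\{\{u_1,\dots,u_n\},v_1,\dots,v_{n-1}\}=\sum_{i=1}^n\{u_1,\dots,u_{i-1},\{u_i,v_1,\dots,v_{n-1}\},u_{i+1},\dots,u_n\}.$$ It is called simple if $A\ne 0$ and the only ideals $I$ of $A$ with $\{I,A,\dots,A\}\subseteq I$ are $0$ and $A$, and central if its center $\{c\in A:\{c,f_2,\dots,f_n\}=0\text{ for all }f_2,\dots,f_n\in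 A\}$ equals $K\cdot 1$. Theorem. Let $C\in K[x_1,\dots,x_{n+1}]$ be a non-constant homogeneous polynomial. Then $C$ is closed if and only if it is not of the form $\alpha c^t$ with $\alpha\in K$, $c\in K[x_1,\dots,x_{n+1}]$ and $t\ge 2$. If $C$ is closed, then for every $0\ne\lambda\in K$ the algebra $S_C=P_C/(C-\lambda)$ is a central simple $n$-Lie-Poisson algebra over $K$. -/

import Mathlib

noncomputable section

namespace NLiePoisson

section General

variable {K : Type*} [Field K] {A : Type*} [CommRing A] [Algebra K A] {n : ℕ}

/-- An `n`-ary skew-symmetric bracket on the commutative algebra `A` (a `K`-multilinear map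
vanishing whenever two arguments coincide) makes `A` an `n`-Lie-Poisson algebra if it satisfies
the Leibniz identity in each slot and the Jacobi (Filippov) identity
`[[u₁,…,uₙ],v₁,…,vₙ₋₁] = ∑ᵢ [u₁,…,[uᵢ,v₁,…,vₙ₋₁],…,uₙ]`.
In `jacobi` the `n - 1` elements `v` are the entries of `v : Fin n → A` outside the slot `s`
(the entry at `s` is overwritten); the usual form is the one with `s` the first slot, and by
skew-symmetry all slots `s` give equivalent identities. -/
structure IsNLiePoisson (β : A [⋀^Fin n]→ₗ[K] A) : Prop where
  leibniz : ∀ (a : Fin n → A) (i : Fin n) (x y : A),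
    β (Function.update a i (x * y)) =
      x * β (Function.update a i y) + β (Function.update a i x) * y
  jacobi : ∀ (s : Fin n) (u v : Fin n → A),
    β (Function.update v s (β u)) =
      ∑ i, β (Function.update u i (β (Function.update v s (u i))))

/-- An ideal `I` of the commutative algebra `A` with `{A, …, I, …, A} ⊆ I`. -/
def IsPoissonIdeal (β : A [⋀^Fin n]→ₗ[K] A) (I : Ideal A) : Prop :=
  ∀ (a : Fin n → A) (i : Fin n), a i ∈ I → β a ∈ I

/-- Simplicity: the algebra is nonzero and its only Poisson ideals are `0` and `A`. -/
def IsSimpleBracket (β : A [⋀^Fin n]→ₗ[K] A) : Prop :=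
  Nontrivial A ∧ ∀ I : Ideal A, IsPoissonIdeal β I → I = ⊥ ∨ I = ⊤

/-- The center: elements `c` such that the bracket vanishes whenever one argument is `c`
(by skew-symmetry it does not matter which one). -/
def center (β : A [⋀^Fin n]→ₗ[K] A) : Set A :=
  {c | ∀ (a : Fin n → A) (i : Fin n), a i = c → β a = 0}

/-- The algebra is central over `K` if its center is `K = K · 1`. -/
def IsCentralBracket (β : A [⋀^Fin n]→ₗ[K] A) : Prop :=
  center β = Set.range (algebraMap K A)

theorem IsPoissonIdeal.sub_mem {β : A [⋀^Fin n]→ₗ[K] A} {I : Ideal A}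
    (hI : IsPoissonIdeal β I) {a b : Fin n → A} (h : ∀ i, a i - b i ∈ I) :
    β a - β b ∈ I := by
  classical
  have key : ∀ s : Finset (Fin n), β (s.piecewise a b) - β b ∈ I := by
    intro s
    induction s using Finset.induction_on with
    | empty => simp
    | insert i s hi ih =>
      have h1 : β ((insert i s).piecewise a b) - β (s.piecewise a b) ∈ I := by
        have e : s.piecewise a b = Function.update (s.piecewise a b) i (b i) := by
          rw [eq_comm, Function.update_eq_self_iff]
          simp [hi]
        rw [Finset.piecewise_insert]
        conv in _ - _ => rw [e]
        rw [Function.update_idem, ← AlternatingMap.map_update_sub]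
        exact hI _ i (by simpa using h i)
      simpa using I.add_mem h1 ih
  simpa using key Finset.univ

/-- The bracket induced on the quotient `A ⧸ I` by a Poisson ideal `I`. -/
def quotientBracket (β : A [⋀^Fin n]→ₗ[K] A) (I : Ideal A) (hI : IsPoissonIdeal β I) :
    (A ⧸ I) [⋀^Fin n]→ₗ[K] (A ⧸ I) where
  toFun x := Ideal.Quotient.mk I (β fun i => (x i).out)
  map_update_add' := by
    intro inst x i p q
    obtain rfl := Subsingleton.elim inst (instDecidableEqFin n)
    rw [← map_add]
    have e : ∀ r : A ⧸ I, Ideal.Quotient.mk I (β fun j => (Function.update x i r j).out) =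
        Ideal.Quotient.mk I (β (Function.update (fun j => (x j).out) i r.out)) := by
      intro r
      congr 2
      funext j
      by_cases hj : j = i
      · subst hj; simp
      · simp [hj]
    rw [map_add, e, e, e, ← map_add, ← AlternatingMap.map_update_add]
    refine Ideal.Quotient.eq.2 (hI.sub_mem fun j => ?_)
    by_cases hj : j = i
    · subst hj
      simp only [Function.update_self]
      rw [← Ideal.Quotient.eq]
      simp [Ideal.Quotient.mk_out]
    · simp [hj]
  map_update_smul' := by
    intro inst x i c p
    obtain rfl := Subsingleton.elim inst (instDecidableEqFin n)
    have e : ∀ r : A ⧸ I, Ideal.Quotient.mk I (β fun j => (Function.update x i r j).out) =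
        Ideal.Quotient.mk I (β (Function.update (fun j => (x j).out) i r.out)) := by
      intro r
      congr 2
      funext j
      by_cases hj : j = i
      · subst hj; simp
      · simp [hj]
    have hs : ∀ a : A, Ideal.Quotient.mk I (c • a) = c • Ideal.Quotient.mk I a := fun a => rfl
    rw [e, e, ← hs, ← AlternatingMap.map_update_smul]
    refine Ideal.Quotient.eq.2 (hI.sub_mem fun j => ?_)
    by_cases hj : j = i
    · subst hj
      simp only [Function.update_self]
      rw [← Ideal.Quotient.eq, hs]
      simp [Ideal.Quotient.mk_out]
    · simp [hj]
  map_eq_zero_of_eq' := by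
    intro x i j hij hne
    rw [β.map_eq_zero_of_eq (i := i) (j := j) _ (by simp [hij]) hne, map_zero]

/-- The induced bracket is computed on arbitrary representatives. -/
theorem quotientBracket_mk (β : A [⋀^Fin n]→ₗ[K] A) (I : Ideal A) (hI : IsPoissonIdeal β I)
    (a : Fin n → A) :
    quotientBracket β I hI (fun i => Ideal.Quotient.mk I (a i)) =
      Ideal.Quotient.mk I (β a) := by
  refine Ideal.Quotient.eq.2 (hI.sub_mem fun i => ?_)
  rw [← Ideal.Quotient.eq]
  simp [Ideal.Quotient.mk_out]

end General

section Polynomial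

variable {K : Type*} [Field K] {n : ℕ}

/-- A polynomial `g` is closed if `K[g]` is integrally closed in the polynomial ring. -/
def IsClosedPolynomial (g : MvPolynomial (Fin n) K) : Prop :=
  IsIntegrallyClosedIn (Algebra.adjoin K {g}) (MvPolynomial (Fin n) K)

/-- The Jacobian `J(f₁,…,fₙ) = det [∂fᵢ/∂xⱼ]`. -/
def jacobian (f : Fin n → MvPolynomial (Fin n) K) : MvPolynomial (Fin n) K :=
  Matrix.det (Matrix.of fun i j => MvPolynomial.pderiv j (f i))

theorem jacobian_update (f : Fin n → MvPolynomial (Fin n) K) (i : Fin n)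
    (p : MvPolynomial (Fin n) K) :
    jacobian (Function.update f i p) =
      Matrix.det (Matrix.updateRow (Matrix.of fun i j => MvPolynomial.pderiv j (f i)) i
        (fun j => MvPolynomial.pderiv j p)) := by
  unfold jacobian
  congr 1
  ext1 k j
  by_cases hk : k = i
  · subst hk; simp
  · simp [hk]

theorem jacobian_update_add (f : Fin n → MvPolynomial (Fin n) K) (i : Fin n)
    (p q : MvPolynomial (Fin n) K) :
    jacobian (Function.update f i (p + q)) =
      jacobian (Function.update f i p) + jacobian (Function.update f i q) := by
  simp only [jacobian_update, ← Matrix.det_updateRow_add]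
  congr 2
  funext j
  simp

theorem jacobian_update_mul (f : Fin n → MvPolynomial (Fin n) K) (i : Fin n)
    (p q : MvPolynomial (Fin n) K) :
    jacobian (Function.update f i (p * q)) =
      p * jacobian (Function.update f i q) + q * jacobian (Function.update f i p) := by
  simp only [jacobian_update, ← Matrix.det_updateRow_smul, ← Matrix.det_updateRow_add]
  congr 2
  funext j
  simp

theorem jacobian_update_C (f : Fin n → MvPolynomial (Fin n) K) (i : Fin n) (c : K) :
    jacobian (Function.update f i (MvPolynomial.C c)) = 0 := by
  rw [jacobian_update]
  refine Matrix.det_eq_zero_of_row_eq_zero i fun j => ?_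
  simp

theorem jacobian_eq_zero_of_eq (f : Fin n → MvPolynomial (Fin n) K) {i j : Fin n}
    (h : f i = f j) (hij : i ≠ j) : jacobian f = 0 :=
  Matrix.det_zero_of_row_eq hij (by funext k; simp [h])

/-- The bracket `{a₁,…,aₙ} = J(a₁,…,aₙ,C)` of `P_C` on `K[x₁,…,xₙ₊₁]`. -/
def bracketP (C : MvPolynomial (Fin (n + 1)) K) :
    MvPolynomial (Fin (n + 1)) K [⋀^Fin n]→ₗ[K] MvPolynomial (Fin (n + 1)) K where
  toFun a := jacobian (Fin.snoc (α := fun _ => MvPolynomial (Fin (n + 1)) K) a C)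
  map_update_add' := by
    intro inst a i p q
    obtain rfl := Subsingleton.elim inst (instDecidableEqFin n)
    simp only [Fin.snoc_update, jacobian_update_add]
  map_update_smul' := by
    intro inst a i c p
    obtain rfl := Subsingleton.elim inst (instDecidableEqFin n)
    simp only [Fin.snoc_update, MvPolynomial.smul_eq_C_mul, jacobian_update_mul,
      jacobian_update_C, mul_zero, add_zero]
  map_eq_zero_of_eq' := by
    intro a i j h hij
    refine jacobian_eq_zero_of_eq _ (i := i.castSucc) (j := j.castSucc) (by simpa using h) ?_
    simpa using hij

theorem isPoissonIdeal_span (C : MvPolynomial (Fin (n + 1)) K) (l : K) :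
    IsPoissonIdeal (bracketP C) (Ideal.span {C - MvPolynomial.C l}) := by
  intro a i hi
  obtain ⟨p, hp⟩ := Ideal.mem_span_singleton'.1 hi
  have e : a = Function.update a i (p * (C - MvPolynomial.C l)) := by
    rw [hp, Function.update_eq_self]
  have hz : jacobian (Function.update (Fin.snoc (α := fun _ => MvPolynomial (Fin (n + 1)) K) a C)
      i.castSucc (C - MvPolynomial.C l)) = 0 := by
    rw [sub_eq_add_neg, ← map_neg, jacobian_update_add, jacobian_update_C, add_zero]
    refine jacobian_eq_zero_of_eq _ (i := i.castSucc) (j := Fin.last n) ?_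
      (Fin.castSucc_lt_last i).ne
    simp [Function.update_of_ne (Fin.castSucc_lt_last i).ne']
  rw [e]
  change jacobian (Fin.snoc (α := fun _ => MvPolynomial (Fin (n + 1)) K) _ C) ∈ _
  rw [Fin.snoc_update, jacobian_update_mul, hz, mul_zero, zero_add]
  exact Ideal.mul_mem_right _ _ (Ideal.mem_span_singleton_self _)

/-- The bracket of `S_C = P_C / (C - l)`. -/
def bracketS (C : MvPolynomial (Fin (n + 1)) K) (l : K) :
    (MvPolynomial (Fin (n + 1)) K ⧸ Ideal.span {C - MvPolynomial.C l}) [⋀^Fin n]→ₗ[K]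
      (MvPolynomial (Fin (n + 1)) K ⧸ Ideal.span {C - MvPolynomial.C l}) :=
  quotientBracket (bracketP C) _ (isPoissonIdeal_span C l)

end Polynomial

end NLiePoisson

end

/-! Everything is controlled by the Hamiltonian derivations H_ij f = ∂ᵢf ∂ⱼC - ∂ⱼf ∂ᵢC, which up to
sign are brackets with the other slots filled by coordinates.

Closedness: elements integral over K[C] are killed by all H_ij. Conversely, if f is homogeneous of
degree d and killed by them, Euler's formula gives d f ∂ⱼC = m C ∂ⱼf, so f^m is proportional to C^d.
If C is not a proper power, unique factorization makes f a scalar times a power of C. Thus the joint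
kernel is K[C].

Center: multiplication by C/λ is the identity on the level C = λ, so any class has a representative
with degrees in a window of length m. Its image under H_ij again fills at most such a window, and a
nonzero multiple of C - λ cannot. So the representative is in K[C], hence constant on the level.

Simplicity: let I be a Poisson ideal and 𝔭 ⊇ I maximal. As mC is the unit mλ on the level, Euler's
formula yields E = ∑ c_ij H_ij with c_ij ∈ 𝔭 that is the identity on 𝔭/𝔭². Then E acts as k on
𝔭^k/𝔭^(k+1) while E(I) ⊆ 𝔭I, so I lies in every 𝔭^k. Krull's intersection theorem makes I
idempotent, hence generated by an idempotent. All H_ij kill that generator, so it is a constant and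
I is trivial.

The Filippov identity holds because the derivation given by a Jacobian with one free slot is
divergence-free. -/

noncomputable section

namespace NLiePoisson

/-! ### The Filippov identity for Jacobians, and its passage to quotients -/

section Filippov

open Matrix MvPolynomial

theorem derivation_prod {K A ι : Type*} [CommRing K] [CommRing A] [Algebra K A] [DecidableEq ι]
    (D : Derivation K A A) (s : Finset ι) (f : ι → A) :
    D (∏ i ∈ s, f i) = ∑ i ∈ s, ∏ j ∈ s, Function.update f i (D (f i)) j := by
  induction s using Finset.induction_on with
  | empty => simp
  | insert a s ha ih =>
    rw [Finset.prod_insert ha, Derivation.leibniz, ih, Finset.sum_insert ha,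
      Finset.prod_insert ha, Function.update_self, smul_eq_mul, smul_eq_mul, add_comm,
      Finset.mul_sum]
    congr 1
    · rw [mul_comm]
      congr 1
      refine Finset.prod_congr rfl fun j hj => ?_
      rw [Function.update_of_ne (ne_of_mem_of_not_mem hj ha)]
    · refine Finset.sum_congr rfl fun i hi => ?_
      rw [Finset.prod_insert ha, Function.update_of_ne (ne_of_mem_of_not_mem hi ha).symm]

theorem derivation_det {K A ι : Type*} [CommRing K] [CommRing A] [Algebra K A] [DecidableEq ι]
    [Fintype ι] (D : Derivation K A A) (M : Matrix ι ι A) :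
    D M.det = ∑ i, (M.updateRow i fun j => D (M i j)).det := by
  have key : ∀ N : Matrix ι ι A, N.det = ∑ σ : Equiv.Perm ι, Equiv.Perm.sign σ • ∏ i, N i (σ i) := by
    intro N
    rw [← det_transpose, det_apply]
    rfl
  simp only [key]
  rw [map_sum, Finset.sum_comm]
  refine Finset.sum_congr rfl fun σ _ => ?_
  rw [← Finset.smul_sum, Units.smul_def, map_zsmul, Units.smul_def, derivation_prod]
  congr 1
  refine Finset.sum_congr rfl fun i _ => Finset.prod_congr rfl fun j _ => ?_
  by_cases h : j = i
  · subst h; simp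
  · simp [h]

theorem det_updateRow_eq_sum_adjugate {A ι : Type*} [CommRing A] [DecidableEq ι] [Fintype ι]
    (M : Matrix ι ι A) (i : ι) (w : ι → A) :
    (M.updateRow i w).det = ∑ l, w l * M.adjugate l i := by
  simp only [adjugate_apply]
  rw [← cramer_transpose_apply, LinearMap.pi_apply_eq_sum_univ (cramer Mᵀ) w, Finset.sum_apply]
  refine Finset.sum_congr rfl fun l _ => ?_
  have : (fun j => if l = j then (1 : A) else 0) = Pi.single l 1 := by
    funext j
    simp [Pi.single_apply, eq_comm]
  rw [Pi.smul_apply, smul_eq_mul, ← cramer_transpose_apply, this]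

/-- The left side is tr(M B adj M); cycling the trace brings adj M next to M. This is the
first-order variation of det(M(1 + tB)). -/
theorem sum_det_updateRow_mul {A ι : Type*} [CommRing A] [DecidableEq ι] [Fintype ι]
    (M B : Matrix ι ι A) :
    ∑ i, (M.updateRow i ((M * B) i)).det = B.trace * M.det := by
  simp only [det_updateRow_eq_sum_adjugate]
  have : ∑ i, ∑ l, (M * B) i l * M.adjugate l i = (M * B * M.adjugate).trace := by
    simp [trace, mul_apply (M := M * B)]
  rw [this, Matrix.mul_assoc, trace_mul_comm, Matrix.mul_assoc, adjugate_mul]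
  simp [mul_comm]

theorem det_updateRow_updateRow_swap {A ι : Type*} [CommRing A] [DecidableEq ι] [Fintype ι]
    (M : Matrix ι ι A) {s i : ι} (h : i ≠ s) (v w : ι → A) :
    ((M.updateRow s v).updateRow i w).det = -((M.updateRow s w).updateRow i v).det := by
  have := (detRowAlternating (R := A) (n := ι)).map_swap ((M.updateRow s w).updateRow i v) h
  change _ = -detRowAlternating _
  rw [← this]
  change det _ = det _
  congr 1
  funext k
  change _ = (M.updateRow s w).updateRow i v (Equiv.swap i s k)
  by_cases hk : k = i
  · subst hk; simp [updateRow_ne h.symm]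
  · by_cases hs : k = s
    · subst hs; simp [updateRow_ne hk]
    · rw [Equiv.swap_apply_of_ne_of_ne hk hs]
      simp [updateRow_ne hk, updateRow_ne hs]

theorem pderiv_pderiv_comm {K σ : Type*} [CommRing K] (i j : σ) (f : MvPolynomial σ K) :
    pderiv i (pderiv j f) = pderiv j (pderiv i f) := by
  classical
  have h : ⁅(pderiv i : Derivation K (MvPolynomial σ K) _), (pderiv j : Derivation K (MvPolynomial σ K) _)⁆ = 0 := by
    refine derivation_ext fun k => ?_
    rw [Derivation.commutator_apply, pderiv_X (R := K), pderiv_X (R := K)]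
    simp only [Pi.single_apply]
    split_ifs <;> simp
  have := congrArg (fun D => D f) h
  simpa [Derivation.commutator_apply, sub_eq_zero] using this

theorem derivation_eq_sum_pderiv {K σ A : Type*} [CommRing K] [Fintype σ] [AddCommGroup A]
    [Module K A] [Module (MvPolynomial σ K) A]
    (D : Derivation K (MvPolynomial σ K) A) (f : MvPolynomial σ K) :
    D f = ∑ k, pderiv k f • D (X k) := by
  classical
  induction f using MvPolynomial.induction_on with
  | C a => simp [derivation_C]
  | add p q hp hq => simp [hp, hq, add_smul, Finset.sum_add_distrib]
  | mul_X p i hp =>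
    rw [Derivation.leibniz, hp, Finset.smul_sum]
    simp only [Derivation.leibniz, pderiv_X, add_smul, Finset.sum_add_distrib, smul_smul,
      smul_eq_mul]
    congr 1
    rw [Finset.sum_eq_single i] <;> simp +contextual [eq_comm]

variable {K : Type*} [Field K] {N : ℕ}

/-- The matrix `[∂fᵢ/∂xⱼ]`. -/
def jacobianMatrix (f : Fin N → MvPolynomial (Fin N) K) :
    Matrix (Fin N) (Fin N) (MvPolynomial (Fin N) K) :=
  of fun i j => pderiv j (f i)

/-- Differentiating the cofactors pairs second derivatives, symmetric in k and l, with determinants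
antisymmetric in k and l, so each sum equals its own negative. -/
theorem sum_pderiv_adjugate_jacobianMatrix [CharZero K] (v : Fin N → MvPolynomial (Fin N) K) (s : Fin N) :
    ∑ k, pderiv k ((jacobianMatrix v).adjugate k s) = 0 := by
  set M := jacobianMatrix v with hM
  have e : ∀ k, pderiv k (M.adjugate k s) = ∑ i ∈ Finset.univ.erase s, ∑ l,
      pderiv k (pderiv l (v i)) *
        ((M.updateRow s (Pi.single k 1)).updateRow i (Pi.single l 1)).det := by
    intro k
    rw [adjugate_apply, derivation_det, ← Finset.sum_erase_add _ _ (Finset.mem_univ s)]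
    rw [det_eq_zero_of_row_eq_zero s (fun j => ?_), add_zero]
    · refine Finset.sum_congr rfl fun i hi => ?_
      rw [det_updateRow_eq_sum_adjugate]
      refine Finset.sum_congr rfl fun l _ => ?_
      rw [updateRow_ne (Finset.ne_of_mem_erase hi), adjugate_apply]
      rfl
    · simp only [updateRow_self, Pi.single_apply]
      split_ifs <;> simp
  simp only [e]
  rw [Finset.sum_comm]
  refine Finset.sum_eq_zero fun i hi => ?_
  rw [← CharZero.eq_neg_self_iff, ← Finset.sum_neg_distrib]
  conv_rhs => simp only [← Finset.sum_neg_distrib]; rw [Finset.sum_comm]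
  refine Finset.sum_congr rfl fun k _ => Finset.sum_congr rfl fun l _ => ?_
  rw [det_updateRow_updateRow_swap _ (Finset.ne_of_mem_erase hi), pderiv_pderiv_comm]
  ring

theorem jacobian_update_eq_sum (v : Fin N → MvPolynomial (Fin N) K) (s : Fin N)
    (f : MvPolynomial (Fin N) K) :
    jacobian (Function.update v s f) =
      ∑ k, (jacobianMatrix v).adjugate k s * pderiv k f := by
  rw [jacobian_update, det_updateRow_eq_sum_adjugate]
  exact Finset.sum_congr rfl fun _ _ => mul_comm _ _

/-- The Filippov identity for the Jacobian. -/
theorem jacobian_filippov [CharZero K] (s : Fin N) (u v : Fin N → MvPolynomial (Fin N) K) :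
    jacobian (Function.update v s (jacobian u)) =
      ∑ i, jacobian (Function.update u i (jacobian (Function.update v s (u i)))) := by
  set c := fun k => (jacobianMatrix v).adjugate k s with hc
  let D : Derivation K (MvPolynomial (Fin N) K) (MvPolynomial (Fin N) K) :=
    mkDerivation K c
  have hD : ∀ f, jacobian (Function.update v s f) = D f := by
    intro f
    rw [jacobian_update_eq_sum, derivation_eq_sum_pderiv D]
    simp [D, hc, mkDerivation_X, mul_comm]
  have hDf : ∀ f, D f = ∑ k, c k * pderiv k f := fun f => by rw [← hD, jacobian_update_eq_sum]
  let B : Matrix (Fin N) (Fin N) (MvPolynomial (Fin N) K) := of fun k j => pderiv j (c k)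
  have hB : B.trace = 0 := sum_pderiv_adjugate_jacobianMatrix v s
  -- Commuting ∂ⱼ past D leaves a term from the coefficients of D; summed over the rows it
  -- contributes the divergence tr B times a determinant, which is 0.
  have hrow : ∀ i, (fun j => pderiv j (D (u i))) =
      (fun j => D (jacobianMatrix u i j)) + (jacobianMatrix u * B) i := by
    intro i
    funext j
    rw [Pi.add_apply, hDf, hDf, mul_apply, map_sum, ← Finset.sum_add_distrib]
    refine Finset.sum_congr rfl fun k _ => ?_
    rw [Derivation.leibniz, pderiv_pderiv_comm]
    simp [jacobianMatrix, B]
  simp only [hD, jacobian_update]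
  change D (jacobianMatrix u).det = ∑ i, ((jacobianMatrix u).updateRow i _).det
  simp only [hrow, det_updateRow_add]
  rw [Finset.sum_add_distrib, sum_det_updateRow_mul, hB, zero_mul, add_zero, derivation_det]

theorem bracketP_apply (C : MvPolynomial (Fin (N + 1)) K) (a : Fin N → MvPolynomial (Fin (N + 1)) K) :
    bracketP C a = jacobian (Fin.snoc (α := fun _ => MvPolynomial (Fin (N + 1)) K) a C) := rfl

theorem isNLiePoisson_bracketP [CharZero K] (C : MvPolynomial (Fin (N + 1)) K) :
    IsNLiePoisson (bracketP C) where
  leibniz a i x y := by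
    simp only [bracketP_apply, Fin.snoc_update, jacobian_update_mul]
    ring
  jacobi s u v := by
    simp only [bracketP_apply, Fin.snoc_update]
    -- The extra summand, in which the derivation hits C, vanishes because C then occupies two
    -- slots.
    rw [jacobian_filippov, Fin.sum_univ_castSucc]
    have hz : jacobian (Function.update (Fin.snoc (α := fun _ => MvPolynomial (Fin (N + 1)) K) v C)
        s.castSucc C) = 0 := by
      refine jacobian_eq_zero_of_eq _ (i := s.castSucc) (j := Fin.last N) ?_
        (Fin.castSucc_lt_last s).ne
      simp [Function.update_of_ne (Fin.castSucc_lt_last s).ne']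
    have hz' := jacobian_update_C (Fin.snoc (α := fun _ => MvPolynomial (Fin (N + 1)) K) u C)
      (Fin.last N) (0 : K)
    rw [map_zero] at hz'
    simp [hz, hz']

theorem IsNLiePoisson.quotient {A : Type*} [CommRing A] [Algebra K A] {n : ℕ}
    {β : A [⋀^Fin n]→ₗ[K] A} (h : IsNLiePoisson β) (I : Ideal A) (hI : IsPoissonIdeal β I) :
    IsNLiePoisson (quotientBracket β I hI) := by
  have hu : ∀ (a : Fin n → A) (i : Fin n) (x : A),
      Function.update (fun j => Ideal.Quotient.mk I (a j)) i (Ideal.Quotient.mk I x) =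
        fun j => Ideal.Quotient.mk I (Function.update a i x j) := by
    intro a i x
    funext j
    by_cases hj : j = i
    · subst hj; simp
    · simp [hj]
  have hs : ∀ a : Fin n → A ⧸ I, ∃ b : Fin n → A, a = fun j => Ideal.Quotient.mk I (b j) := by
    intro a
    choose b hb using fun j => Ideal.Quotient.mk_surjective (a j)
    exact ⟨b, funext fun j => (hb j).symm⟩
  constructor
  · intro a i x y
    obtain ⟨a, rfl⟩ := hs a
    obtain ⟨x, rfl⟩ := Ideal.Quotient.mk_surjective x
    obtain ⟨y, rfl⟩ := Ideal.Quotient.mk_surjective y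
    rw [← map_mul, hu, hu, hu, quotientBracket_mk, quotientBracket_mk, quotientBracket_mk,
      h.leibniz, map_add, map_mul, map_mul]
  · intro s u v
    obtain ⟨u, rfl⟩ := hs u
    obtain ⟨v, rfl⟩ := hs v
    simp only [hu, quotientBracket_mk]
    rw [h.jacobi, map_sum]

end Filippov

/-! ### Hamiltonian derivations as special brackets -/

section Minors

open Matrix MvPolynomial

/-- The matrix is a rank-two perturbation 1 + PQ of the identity, and det(1 + PQ) = det(1 + QP) is a
2 × 2 determinant. -/
theorem det_updateRow_updateRow_one {A ι : Type*} [CommRing A] [DecidableEq ι] [Fintype ι]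
    {i j : ι} (h : i ≠ j) (u v : ι → A) :
    (((1 : Matrix ι ι A).updateRow i u).updateRow j v).det = u i * v j - u j * v i := by
  let P : Matrix ι (Fin 2) A := of fun k r => if r = 0 then (Pi.single i 1 : ι → A) k else (Pi.single j 1 : ι → A) k
  let Q : Matrix (Fin 2) ι A := of fun r k =>
    if r = 0 then u k - (Pi.single i 1 : ι → A) k else v k - (Pi.single j 1 : ι → A) k
  have e : ((1 : Matrix ι ι A).updateRow i u).updateRow j v = 1 + P * Q := by
    ext k l
    rw [Matrix.add_apply, mul_apply, Fin.sum_univ_two]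
    by_cases hj : k = j
    · subst hj
      simp [P, Q, one_apply, Pi.single_apply, eq_comm, if_neg h]
    · by_cases hi : k = i
      · subst hi
        simp [P, Q, h, one_apply, Pi.single_apply, eq_comm, if_neg h.symm]
      · simp [P, Q, hj, hi]
  rw [e, det_one_add_mul_comm, det_fin_two]
  simp [P, Q, mul_apply, Pi.single_apply, h, h.symm]

variable {K : Type*} [Field K] {N : ℕ}

/-- The Hamiltonian derivation `f ↦ ∂ᵢf ∂ⱼC - ∂ⱼf ∂ᵢC`. -/
def hamiltonian (C : MvPolynomial (Fin N) K) (i j : Fin N) :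
    Derivation K (MvPolynomial (Fin N) K) (MvPolynomial (Fin N) K) :=
  pderiv j C • pderiv i - pderiv i C • pderiv j

theorem hamiltonian_apply (C : MvPolynomial (Fin N) K) (i j : Fin N)
    (f : MvPolynomial (Fin N) K) :
    hamiltonian C i j f = pderiv i f * pderiv j C - pderiv j f * pderiv i C := by
  simp [hamiltonian, mul_comm]

theorem jacobian_update_update_X (C f : MvPolynomial (Fin N) K) {i j : Fin N} (h : i ≠ j) :
    jacobian (Function.update (Function.update X i f) j C) = hamiltonian C i j f := by
  rw [hamiltonian_apply, ← det_updateRow_updateRow_one h (fun k => pderiv k f) fun k => pderiv k C,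
    jacobian_update]
  congr 2
  ext k l : 1
  by_cases hi : k = i
  · subst hi; simp
  · simp [hi, one_apply, pderiv_X, Pi.single_apply]

theorem jacobian_comp_perm (f : Fin N → MvPolynomial (Fin N) K) (σ : Equiv.Perm (Fin N)) :
    jacobian (f ∘ σ) = Equiv.Perm.sign σ * jacobian f :=
  det_permute σ (of fun i j => pderiv j (f i))

/-- The free slots are filled with coordinates; the sign comes from the transposition moving C to
the last slot. This gives Poisson ideals and central elements control over every Hamiltonian
derivation. -/
theorem exists_bracketP_eq_hamiltonian (C f : MvPolynomial (Fin (N + 1)) K) {i j : Fin (N + 1)}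
    (h : i ≠ j) : ∃ (a : Fin N → MvPolynomial (Fin (N + 1)) K) (k : Fin N), a k = f ∧
      (bracketP C a = hamiltonian C i j f ∨ bracketP C a = -hamiltonian C i j f) := by
  set g : Fin (N + 1) → MvPolynomial (Fin (N + 1)) K :=
    Function.update (Function.update X i f) j C with hg
  set σ := Equiv.swap j (Fin.last N) with hσ
  have hlast : (g ∘ σ) (Fin.last N) = C := by simp [hσ, hg]
  have hk : σ i ≠ Fin.last N := by
    intro e
    apply h
    rw [← Equiv.swap_apply_left j (Fin.last N)] at e
    exact σ.injective e
  refine ⟨Fin.init (g ∘ σ), (σ i).castPred hk, ?_, ?_⟩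
  · simp [Fin.init, hσ, hg, h]
  · have e : bracketP C (Fin.init (g ∘ σ)) = jacobian (g ∘ σ) := by
      rw [bracketP_apply]
      conv_lhs => rw [← hlast]
      rw [Fin.snoc_init_self]
    rw [e, jacobian_comp_perm, jacobian_update_update_X C f h]
    rcases Int.units_eq_one_or (Equiv.Perm.sign σ) with hs | hs <;> simp [hs]

theorem IsPoissonIdeal.hamiltonian_mem {C : MvPolynomial (Fin (N + 1)) K}
    {I : Ideal (MvPolynomial (Fin (N + 1)) K)} (hI : IsPoissonIdeal (bracketP C) I)
    {f : MvPolynomial (Fin (N + 1)) K} (hf : f ∈ I) (i j : Fin (N + 1)) :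
    hamiltonian C i j f ∈ I := by
  by_cases h : i = j
  · subst h
    simp [hamiltonian_apply]
  obtain ⟨a, k, hk, ha⟩ := exists_bracketP_eq_hamiltonian C f h
  have := hI a k (hk ▸ hf)
  rcases ha with ha | ha
  · rwa [← ha]
  · rwa [ha, neg_mem_iff] at this

end Minors

/-! ### Degrees of Hamiltonian derivations, and integral elements -/

section Closed

open MvPolynomial

variable {K : Type*} [Field K] {N : ℕ}

theorem hamiltonian_self (C : MvPolynomial (Fin N) K) (i j : Fin N) :
    hamiltonian C i j C = 0 := by
  rw [hamiltonian_apply]; ring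

theorem decompose_homogeneousSubmodule_apply {σ R : Type*} [CommRing R] (p : MvPolynomial σ R)
    (k : ℕ) :
    let _ := MvPolynomial.gradedAlgebra (σ := σ) (R := R)
    (DirectSum.decompose (homogeneousSubmodule σ R) p k : MvPolynomial σ R) =
      homogeneousComponent k p :=
  decomposition.decompose'_apply p k

theorem homogeneousComponent_mul_of_le {σ R : Type*} [CommRing R] {m k : ℕ}
    {p : MvPolynomial σ R} (hp : p.IsHomogeneous m) (q : MvPolynomial σ R) (h : m ≤ k) :
    homogeneousComponent k (p * q) = p * homogeneousComponent (k - m) q := by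
  let _ := MvPolynomial.gradedAlgebra (σ := σ) (R := R)
  have := DirectSum.coe_decompose_mul_of_left_mem_of_le (homogeneousSubmodule σ R) (b := q) hp h
  rwa [decompose_homogeneousSubmodule_apply, decompose_homogeneousSubmodule_apply] at this

theorem homogeneousComponent_mul_of_lt {σ R : Type*} [CommRing R] {m k : ℕ}
    {p : MvPolynomial σ R} (hp : p.IsHomogeneous m) (q : MvPolynomial σ R) (h : k < m) :
    homogeneousComponent k (p * q) = 0 := by
  let _ := MvPolynomial.gradedAlgebra (σ := σ) (R := R)
  have := DirectSum.coe_decompose_mul_of_left_mem_of_not_le (homogeneousSubmodule σ R) (b := q) hp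
    h.not_ge
  rwa [decompose_homogeneousSubmodule_apply] at this

theorem homogeneousComponent_pderiv {σ R : Type*} [CommRing R] (k : ℕ) (i : σ)
    (f : MvPolynomial σ R) :
    homogeneousComponent k (pderiv i f) = pderiv i (homogeneousComponent (k + 1) f) := by
  ext d
  rw [coeff_homogeneousComponent, coeff_pderiv, coeff_pderiv, coeff_homogeneousComponent]
  simp only [map_add, Finsupp.degree_single, add_left_inj]
  split_ifs <;> simp

/-- The degree shift is m - 2. Source degree k + 1 suffices, since constants are killed, and `m - 1`
is the degree of the partial derivatives of C. -/
theorem homogeneousComponent_hamiltonian {C : MvPolynomial (Fin N) K} {m : ℕ}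
    (hC : C.IsHomogeneous m) (i j : Fin N) (f : MvPolynomial (Fin N) K) (k : ℕ) :
    homogeneousComponent (m - 1 + k) (hamiltonian C i j f) =
      hamiltonian C i j (homogeneousComponent (k + 1) f) := by
  rw [hamiltonian_apply, hamiltonian_apply, map_sub, mul_comm, mul_comm (pderiv j f),
    homogeneousComponent_mul_of_le hC.pderiv _ (by omega),
    homogeneousComponent_mul_of_le hC.pderiv _ (by omega), homogeneousComponent_pderiv,
    homogeneousComponent_pderiv, Nat.add_sub_cancel_left]
  ring

theorem homogeneousComponent_hamiltonian_of_lt {C : MvPolynomial (Fin N) K} {m : ℕ}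
    (hC : C.IsHomogeneous m) (i j : Fin N) (f : MvPolynomial (Fin N) K) {k : ℕ} (hk : k < m - 1) :
    homogeneousComponent k (hamiltonian C i j f) = 0 := by
  rw [hamiltonian_apply, map_sub, mul_comm, mul_comm (pderiv j f),
    homogeneousComponent_mul_of_lt hC.pderiv _ hk,
    homogeneousComponent_mul_of_lt hC.pderiv _ hk, sub_zero]

/-- A derivation vanishing on a subring vanishes on the elements integral over it, in
characteristic zero. -/
theorem derivation_eq_zero_of_isIntegral {R A : Type*} [CommRing R] [CommRing A] [IsDomain A]
    [CharZero A] [Algebra R A] [FaithfulSMul R A] (D : Derivation R A A) {x : A}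
    (hx : IsIntegral R x) : D x = 0 := by
  have : IsDomain R := (FaithfulSMul.algebraMap_injective R A).isDomain _
  have : CharZero R := 
    ⟨fun a b h => by simpa using congrArg (algebraMap R A) h⟩
  classical
  by_contra hD
  -- Applying D to p(x) = 0 gives p'(x) D x = 0, so x is a root of p' as well; descending the degree
  -- ends at a nonzero constant.
  have key : ∀ d : ℕ, ∀ p : Polynomial R, p.natDegree ≤ d → p ≠ 0 → Polynomial.aeval x p ≠ 0 := by
    intro d
    induction d with
    | zero =>
      intro p hp h0 hz
      rw [Polynomial.eq_C_of_natDegree_le_zero hp, Polynomial.aeval_C] at hz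
      have := FaithfulSMul.algebraMap_injective R A (hz.trans (map_zero _).symm)
      apply h0
      rw [Polynomial.eq_C_of_natDegree_le_zero hp, this, map_zero]
    | succ d ih =>
      intro p hp h0 hz
      by_cases hd : p.natDegree = 0
      · exact ih p (by omega) h0 hz
      have h1 : D (Polynomial.aeval x p) = Polynomial.aeval x p.derivative • D x :=
        D.map_aeval p x
      rw [hz, map_zero, smul_eq_mul, eq_comm] at h1
      refine ih p.derivative ?_ ?_ ((mul_eq_zero.1 h1).resolve_right hD)
      · have := Polynomial.natDegree_derivative_lt hd
        omega
      · intro h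
        exact hd (Polynomial.derivative_eq_zero.1 h)
  obtain ⟨p, hp, hz⟩ := hx
  exact key _ p le_rfl hp.ne_zero hz

theorem hamiltonian_eq_zero_of_isIntegral [CharZero K] {C f : MvPolynomial (Fin N) K}
    (hf : IsIntegral (Algebra.adjoin K {C}) f) (i j : Fin N) : hamiltonian C i j f = 0 := by
  have h0 : ∀ y ∈ Algebra.adjoin K {C}, hamiltonian C i j y = 0 := by
    intro y hy
    induction hy using Algebra.adjoin_induction with
    | mem x hx => rw [Set.mem_singleton_iff.1 hx, hamiltonian_self]
    | algebraMap r => exact Derivation.map_algebraMap _ r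
    | add x y _ _ hx hy => rw [map_add, hx, hy, add_zero]
    | mul x y _ _ hx hy => rw [Derivation.leibniz, hx, hy, smul_zero, smul_zero, add_zero]
  let D : Derivation (Algebra.adjoin K {C}) (MvPolynomial (Fin N) K) (MvPolynomial (Fin N) K) :=
    Derivation.mk'
      { toFun := hamiltonian C i j
        map_add' := map_add _
        map_smul' := fun r x => by
          rw [Algebra.smul_def, Derivation.leibniz]
          change _ + x • hamiltonian C i j (r : MvPolynomial (Fin N) K) = _
          rw [h0 _ r.2, smul_zero, add_zero, RingHom.id_apply]
          rfl } fun a b => Derivation.leibniz _ a b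
  exact derivation_eq_zero_of_isIntegral D hf

end Closed

/-! ### Proper powers and the joint kernel K[P] -/

section PowerCriterion

open MvPolynomial

/-- In a unique factorization domain, if `aᵐ` and `bᵈ` are associated and `b` is not associated
to a proper power, then `a` is associated to a power of `b`. -/
theorem exists_associated_pow_of_associated_pow {A : Type*} [CommRing A] [IsDomain A]
    [UniqueFactorizationMonoid A] {a b : A} (ha : a ≠ 0) (hb : b ≠ 0) {m d : ℕ} (hm : m ≠ 0)
    (h : Associated (a ^ m) (b ^ d)) (hp : ∀ (c : A) (t : ℕ), 2 ≤ t → ¬ Associated (c ^ t) b) :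
    ∃ k, Associated a (b ^ k) := by
  classical
  let _ := UniqueFactorizationMonoid.strongNormalizationMonoid (α := A)
  have hf : ∀ p, m * (UniqueFactorizationMonoid.normalizedFactors a).count p =
      d * (UniqueFactorizationMonoid.normalizedFactors b).count p := by
    intro p
    rw [UniqueFactorizationMonoid.associated_iff_normalizedFactors_eq_normalizedFactors
      (pow_ne_zero _ ha) (pow_ne_zero _ hb), UniqueFactorizationMonoid.normalizedFactors_pow,
      UniqueFactorizationMonoid.normalizedFactors_pow] at h
    rw [← Multiset.count_nsmul, h, Multiset.count_nsmul]
  -- After division by the gcd, the coprime m' and d' satisfy m' v_p(a) = d' v_p(b). So m' divides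
  -- every v_p(b), b is an m'-th power up to a unit, and m' = 1.
  have hg : 0 < m.gcd d := Nat.gcd_pos_of_pos_left _ (Nat.pos_of_ne_zero hm)
  obtain ⟨m', hm'⟩ := Nat.gcd_dvd_left m d
  obtain ⟨d', hd'⟩ := Nat.gcd_dvd_right m d
  have hco : Nat.Coprime m' d' := by
    refine Nat.eq_of_mul_eq_mul_left hg ?_
    rw [← Nat.gcd_mul_left, ← hm', ← hd', mul_one]
  have hf' : ∀ p, m' * (UniqueFactorizationMonoid.normalizedFactors a).count p =
      d' * (UniqueFactorizationMonoid.normalizedFactors b).count p := by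
    intro p
    refine Nat.eq_of_mul_eq_mul_left hg ?_
    rw [← mul_assoc, ← mul_assoc, ← hm', ← hd', hf]
  obtain ⟨s, hs⟩ := Multiset.exists_smul_of_dvd_count
    (UniqueFactorizationMonoid.normalizedFactors b) (k := m')
    fun p _ => hco.dvd_of_dvd_mul_left ⟨_, (hf' p).symm⟩
  have hbs : Associated (s.prod ^ m') b := by
    rw [← Multiset.prod_nsmul, ← hs]
    exact UniqueFactorizationMonoid.prod_normalizedFactors hb
  have hm1 : m' = 1 := by
    have h0 : m' ≠ 0 := by rintro rfl; simp at hm'; exact hm hm'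
    by_contra h1
    exact hp _ m' (by omega) hbs
  refine ⟨d', ?_⟩
  rw [UniqueFactorizationMonoid.associated_iff_normalizedFactors_eq_normalizedFactors
      ha (pow_ne_zero _ hb), UniqueFactorizationMonoid.normalizedFactors_pow]
  ext p
  rw [Multiset.count_nsmul, ← hf', hm1, one_mul]

theorem coeff_X_mul_pderiv {K σ : Type*} [Field K] (i : σ) (f : MvPolynomial σ K)
    (d : σ →₀ ℕ) : coeff d (X i * pderiv i f) = d i * coeff d f := by
  classical
  induction f using MvPolynomial.induction_on' with
  | monomial u a =>
    rw [X_mul_pderiv_monomial, coeff_smul, nsmul_eq_mul, coeff_monomial]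
    split_ifs with h
    · rw [h]
    · simp
  | add p q hp hq => rw [map_add, mul_add, coeff_add, hp, hq, coeff_add, mul_add]

variable {K : Type*} [Field K] {N : ℕ}

/-- The operator Xᵢ∂ᵢ scales the coefficient at an exponent e by eᵢ, so comparing coefficients at
the sum of the two leading exponents forces these to agree in each coordinate. -/
theorem degree_eq_of_wronskian [CharZero K] {F G : MvPolynomial (Fin N) K} (hF : F ≠ 0)
    (hG : G ≠ 0) (h : ∀ i, F * pderiv i G = G * pderiv i F) :
    MonomialOrder.lex.degree F = MonomialOrder.lex.degree G := by
  have hle : ∀ (f : MvPolynomial (Fin N) K) (i : Fin N),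
      MonomialOrder.lex.toSyn (MonomialOrder.lex.degree (X i * pderiv i f)) ≤
        MonomialOrder.lex.toSyn (MonomialOrder.lex.degree f) := by
    intro f i
    rw [MonomialOrder.degree_le_iff]
    intro c hc
    apply MonomialOrder.le_degree
    rw [mem_support_iff, coeff_X_mul_pderiv] at hc
    exact mem_support_iff.2 (right_ne_zero_of_mul hc)
  ext i
  have e : F * (X i * pderiv i G) = G * (X i * pderiv i F) := by
    linear_combination X i * h i
  have e1 := congrArg (coeff (MonomialOrder.lex.degree F + MonomialOrder.lex.degree G)) e
  rw [MonomialOrder.coeff_mul_of_add_of_degree_le le_rfl (hle G i), add_comm,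
    MonomialOrder.coeff_mul_of_add_of_degree_le le_rfl (hle F i), coeff_X_mul_pderiv,
    coeff_X_mul_pderiv] at e1
  have hF' := MonomialOrder.lex.leadingCoeff_ne_zero_iff.2 hF
  have hG' := MonomialOrder.lex.leadingCoeff_ne_zero_iff.2 hG
  unfold MonomialOrder.leadingCoeff at hF' hG'
  have e2 : ((MonomialOrder.lex.degree G i : ℕ) : K) = (MonomialOrder.lex.degree F i : ℕ) := by
    refine mul_right_cancel₀ (mul_ne_zero hF' hG') ?_
    linear_combination e1
  exact_mod_cast e2.symm

/-- Polynomials with vanishing Wronskians are proportional. -/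
theorem exists_eq_C_mul_of_wronskian [CharZero K] {F G : MvPolynomial (Fin N) K}
    (hG : G ≠ 0) (h : ∀ i, F * pderiv i G = G * pderiv i F) : ∃ c : K, F = C c * G := by
  set β := MonomialOrder.lex.degree G
  have hG' : coeff β G ≠ 0 := MonomialOrder.lex.leadingCoeff_ne_zero_iff.2 hG
  refine ⟨coeff β F / coeff β G, ?_⟩
  -- The constant cancels the coefficient at the leading exponent of G. A nonzero difference would
  -- inherit the Wronskian relations and so have that same leading exponent.
  by_contra hne
  have hH := sub_ne_zero.2 hne
  have hd := degree_eq_of_wronskian hH hG fun i => by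
    rw [map_sub, pderiv_C_mul]
    linear_combination h i
  apply MonomialOrder.lex.leadingCoeff_ne_zero_iff.2 hH
  unfold MonomialOrder.leadingCoeff
  rw [hd, coeff_sub, coeff_C_mul, div_mul_cancel₀ _ hG', sub_self]

theorem eq_C_of_isHomogeneous_zero {σ : Type*} {f : MvPolynomial σ K} (h : f.IsHomogeneous 0) :
    f = C (coeff 0 f) := by
  rw [← homogeneousComponent_zero, homogeneousComponent_eq_self h]

/-- Contract the relations with Xᵢ and use Euler's formula for both polynomials. -/
theorem euler_of_hamiltonian_eq_zero {P f : MvPolynomial (Fin N) K} {m d : ℕ}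
    (hP : P.IsHomogeneous m) (hf : f.IsHomogeneous d) (h : ∀ i j, hamiltonian P i j f = 0)
    (j : Fin N) : d * f * pderiv j P = m * P * pderiv j f := by
  have e1 := hP.sum_X_mul_pderiv
  have e2 := hf.sum_X_mul_pderiv
  rw [nsmul_eq_mul] at e1 e2
  rw [← e1, ← e2, Finset.sum_mul, Finset.sum_mul]
  refine Finset.sum_congr rfl fun i _ => ?_
  have := h i j
  rw [hamiltonian_apply] at this
  linear_combination X i * this

theorem mem_adjoin_of_isHomogeneous_of_hamiltonian_eq_zero [CharZero K]
    {P f : MvPolynomial (Fin N) K} {m d : ℕ} (hm : m ≠ 0) (hP : P.IsHomogeneous m) (hP0 : P ≠ 0)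
    (hp : ¬ ∃ (a : K) (c : MvPolynomial (Fin N) K) (t : ℕ), 2 ≤ t ∧ P = C a * c ^ t)
    (hf : f.IsHomogeneous d) (h : ∀ i j, hamiltonian P i j f = 0) :
    f ∈ Algebra.adjoin K {P} := by
  by_cases hf0 : f = 0
  · rw [hf0]; exact zero_mem _
  rcases d with _ | d
  · rw [eq_C_of_isHomogeneous_zero hf]
    exact Subalgebra.algebraMap_mem _ _
  obtain ⟨m, rfl⟩ := Nat.exists_eq_succ_of_ne_zero hm
  obtain ⟨c, hc⟩ := exists_eq_C_mul_of_wronskian (F := f ^ (m + 1)) (G := P ^ (d + 1))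
    (pow_ne_zero _ hP0) fun j => by
      have := euler_of_hamiltonian_eq_zero hP hf h j
      rw [pderiv_pow, pderiv_pow, Nat.add_sub_cancel, Nat.add_sub_cancel]
      linear_combination f ^ m * P ^ d * this
  have hc0 : c ≠ 0 := by
    rintro rfl
    rw [map_zero, zero_mul] at hc
    exact hf0 (pow_eq_zero_iff (by omega) |>.1 hc)
  have hcu : IsUnit (C c : MvPolynomial (Fin N) K) := (isUnit_iff_ne_zero.2 hc0).map C
  obtain ⟨k, u, hk⟩ := exists_associated_pow_of_associated_pow hf0 hP0 (d := d + 1) hm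
    (by rw [hc]; exact Associated.symm ⟨hcu.unit, mul_comm _ _⟩) fun q t ht ⟨u, hu⟩ => by
      obtain ⟨a, -, ha⟩ := isUnit_iff_eq_C_of_isReduced.1 u.isUnit
      exact hp ⟨a, q, t, ht, by rw [← hu, ha, mul_comm]⟩
  obtain ⟨a, ha, hau⟩ := isUnit_iff_eq_C_of_isReduced.1 u⁻¹.isUnit
  have : f = P ^ k * C a := by rw [← hk, ← hau, mul_assoc, Units.mul_inv, mul_one]
  rw [this]
  exact mul_mem (pow_mem (Algebra.self_mem_adjoin_singleton K P) _)
    (Subalgebra.algebraMap_mem _ a)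

theorem mem_adjoin_of_hamiltonian_eq_zero [CharZero K]
    {P f : MvPolynomial (Fin N) K} {m : ℕ} (hm : m ≠ 0) (hP : P.IsHomogeneous m) (hP0 : P ≠ 0)
    (hp : ¬ ∃ (a : K) (c : MvPolynomial (Fin N) K) (t : ℕ), 2 ≤ t ∧ P = C a * c ^ t)
    (h : ∀ i j, hamiltonian P i j f = 0) : f ∈ Algebra.adjoin K {P} := by
  rw [← sum_homogeneousComponent f]
  refine sum_mem fun d _ => ?_
  cases d with
  | zero =>
    rw [homogeneousComponent_zero]
    exact Subalgebra.algebraMap_mem _ _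
  | succ d =>
    refine mem_adjoin_of_isHomogeneous_of_hamiltonian_eq_zero hm hP hP0 hp
      (homogeneousComponent_isHomogeneous _ _) fun i j => ?_
    rw [← homogeneousComponent_hamiltonian hP, h, map_zero]

theorem transcendental_of_isHomogeneous [CharZero K] {P : MvPolynomial (Fin N) K} {m : ℕ}
    (hm : m ≠ 0) (hP : P.IsHomogeneous m) (hP0 : P ≠ 0) : Transcendental K P := by
  intro h
  have hd : ∀ i, pderiv i P = 0 := fun i =>
    derivation_eq_zero_of_isIntegral (pderiv i) (isAlgebraic_iff_isIntegral.1 h)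
  have := hP.sum_X_mul_pderiv
  simp only [hd, mul_zero, Finset.sum_const_zero, nsmul_eq_mul] at this
  rw [eq_comm, mul_eq_zero] at this
  exact this.elim (by exact_mod_cast hm) hP0

theorem isClosedPolynomial_iff [CharZero K] {P : MvPolynomial (Fin N) K} {m : ℕ}
    (hm : m ≠ 0) (hP : P.IsHomogeneous m) (hP0 : P ≠ 0) :
    IsClosedPolynomial P ↔
      ¬ ∃ (a : K) (c : MvPolynomial (Fin N) K) (t : ℕ), 2 ≤ t ∧ P = C a * c ^ t := by
  rw [IsClosedPolynomial, isIntegrallyClosedIn_iff]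
  constructor
  · rintro ⟨-, hcl⟩ ⟨a, c, t, ht, e⟩
    have ha : a ≠ 0 := by rintro rfl; simp at e; exact hP0 e
    have hint : IsIntegral (Algebra.adjoin K {P}) c := by
      refine IsIntegral.of_pow (n := t) (by omega) ?_
      have : c ^ t = algebraMap (Algebra.adjoin K {P}) _
          (⟨C a⁻¹ * P, mul_mem (Subalgebra.algebraMap_mem _ _)
            (Algebra.self_mem_adjoin_singleton K P)⟩) := by
        change _ = C a⁻¹ * P
        rw [e, ← mul_assoc, ← map_mul, inv_mul_cancel₀ ha, map_one, one_mul]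
      rw [this]
      exact isIntegral_algebraMap
    obtain ⟨y, hy⟩ := hcl hint
    have hc : c ∈ Algebra.adjoin K {P} := by rw [← hy]; exact y.2
    rw [Algebra.adjoin_singleton_eq_range_aeval] at hc
    obtain ⟨p, rfl⟩ := hc
    -- If c = p(P), transcendence of P turns P = a p(P)^t into an identity in one variable, whose
    -- degrees read 1 = t deg p.
    have hq : Polynomial.X = Polynomial.C a * p ^ t := by
      apply transcendental_iff_injective.1 (transcendental_of_isHomogeneous hm hP hP0)
      rw [Polynomial.aeval_X, map_mul, map_pow, Polynomial.aeval_C]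
      exact e
    have hn := congrArg Polynomial.natDegree hq
    rw [Polynomial.natDegree_X, Polynomial.natDegree_C_mul ha, Polynomial.natDegree_pow] at hn
    have := Nat.eq_one_of_mul_eq_one_right hn.symm
    omega
  · intro hp
    refine ⟨Subtype.val_injective, fun {x} hx => ?_⟩
    exact ⟨⟨x, mem_adjoin_of_hamiltonian_eq_zero hm hP hP0 hp
      (hamiltonian_eq_zero_of_isIntegral hx)⟩, rfl⟩

end PowerCriterion

/-! ### Degree windows on the level P = l, and the center -/

section Level

open MvPolynomial

theorem eq_zero_of_homogeneousComponent_eq_zero {σ R : Type*} [CommRing R]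
    {f : MvPolynomial σ R} (h : ∀ k, homogeneousComponent k f = 0) : f = 0 := by
  rw [← sum_homogeneousComponent f]
  exact Finset.sum_eq_zero fun k _ => h k

variable {K : Type*} [Field K] {N : ℕ}

/-- A multiple of `P - l`, with `P` homogeneous of degree `m` and `l ≠ 0`, cannot have all its
homogeneous components in a range of `m` consecutive degrees, unless it vanishes. -/
theorem eq_zero_of_mem_span_of_homogeneousComponent {σ : Type*} {P : MvPolynomial σ K} {m : ℕ}
    (hm : m ≠ 0) (hP : P.IsHomogeneous m) (hP0 : P ≠ 0) {l : K} (hl : l ≠ 0)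
    {h : MvPolynomial σ K} (hh : h ∈ Ideal.span {P - C l}) (M : ℕ)
    (hlow : ∀ k < M, homogeneousComponent k h = 0)
    (hhigh : ∀ k, M + m ≤ k → homogeneousComponent k h = 0) : h = 0 := by
  obtain ⟨q, rfl⟩ := Ideal.mem_span_singleton.1 hh
  -- The degree k part of (P - l)q is P q_(k-m) - l q_k. Upward induction clears q below M; downward
  -- induction from the total degree clears it from M on.
  have hq1 : ∀ k < M, homogeneousComponent k q = 0 := by
    intro k
    induction k using Nat.strong_induction_on with
    | _ k ih =>
      intro hk
      have e := hlow k hk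
      rw [sub_mul, map_sub, homogeneousComponent_C_mul] at e
      have e2 : homogeneousComponent k (P * q) = 0 := by
        by_cases hmk : m ≤ k
        · rw [homogeneousComponent_mul_of_le hP _ hmk, ih (k - m) (by omega) (by omega), mul_zero]
        · exact homogeneousComponent_mul_of_lt hP _ (by omega)
      rw [e2, zero_sub, neg_eq_zero, mul_eq_zero] at e
      exact e.resolve_left (by simpa using hl)
  have hq2 : ∀ j k, M ≤ k → q.totalDegree < k + j → homogeneousComponent k q = 0 := by
    intro j
    induction j with
    | zero => intro k _ hk; exact homogeneousComponent_eq_zero _ _ hk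
    | succ j ih =>
      intro k hMk hk
      have e := hhigh (k + m) (by omega)
      rw [sub_mul, map_sub, homogeneousComponent_C_mul, ih (k + m) (by omega) (by omega),
        mul_zero, sub_zero, homogeneousComponent_mul_of_le hP _ (by omega), Nat.add_sub_cancel,
        mul_eq_zero] at e
      exact e.resolve_left hP0
  have : q = 0 := by
    refine eq_zero_of_homogeneousComponent_eq_zero fun k => ?_
    by_cases hk : k < M
    · exact hq1 k hk
    · exact hq2 (q.totalDegree + 1) k (by omega) (by omega)
  rw [this, mul_zero]

/-- Multiplying by P/l changes nothing modulo P - l and raises the degree by m, so it can be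
repeated until the degree enters [M, M + m). The number r bounds the repetitions. -/
theorem exists_isHomogeneous_sub_mem_span {σ : Type*} {P : MvPolynomial σ K} {m : ℕ}
    (hm : m ≠ 0) (hP : P.IsHomogeneous m) {l : K} (hl : l ≠ 0) (M r : ℕ) :
    ∀ (d : ℕ) (f : MvPolynomial σ K), f.IsHomogeneous d → d < M + m → M ≤ d + r →
      ∃ f' : MvPolynomial σ K, f - f' ∈ Ideal.span {P - C l} ∧
        ∀ k, k < M ∨ M + m ≤ k → homogeneousComponent k f' = 0 := by
  induction r with
  | zero =>
    intro d f hf hd hM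
    refine ⟨f, by simp, fun k hk => ?_⟩
    rw [homogeneousComponent_of_mem hf, if_neg (by omega)]
  | succ r ih =>
    intro d f hf hd hM
    by_cases hdM : M ≤ d
    · exact ih d f hf hd (by omega)
    · have hf2 : (C l⁻¹ * (P * f)).IsHomogeneous (m + d) := by
        have := (isHomogeneous_C σ l⁻¹).mul (hP.mul hf)
        rwa [zero_add] at this
      obtain ⟨f', h1, h2⟩ := ih (m + d) _ hf2 (by omega) (by omega)
      refine ⟨f', ?_, h2⟩
      have e : f - f' = (C l⁻¹ * (P * f) - f') + (- C l⁻¹ * f) * (P - C l) := by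
        have : (C l⁻¹ * C l : MvPolynomial σ K) = 1 := by
          rw [← map_mul, inv_mul_cancel₀ hl, map_one]
        linear_combination -f * this
      rw [e]
      exact add_mem h1 (Ideal.mul_mem_left _ _ (Ideal.mem_span_singleton_self _))

theorem exists_sub_mem_span {σ : Type*} {P : MvPolynomial σ K} {m : ℕ}
    (hm : m ≠ 0) (hP : P.IsHomogeneous m) {l : K} (hl : l ≠ 0) (f : MvPolynomial σ K) :
    ∃ (M : ℕ) (f' : MvPolynomial σ K), M ≠ 0 ∧ f - f' ∈ Ideal.span {P - C l} ∧
        ∀ k, k < M ∨ M + m ≤ k → homogeneousComponent k f' = 0 := by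
  have key : ∀ d : ℕ, ∃ f' : MvPolynomial σ K, d < f.totalDegree + 1 →
      homogeneousComponent d f - f' ∈ Ideal.span {P - C l} ∧
        ∀ k, k < f.totalDegree + 1 ∨ f.totalDegree + 1 + m ≤ k →
          homogeneousComponent k f' = 0 := by
    intro d
    by_cases hd : d < f.totalDegree + 1
    · obtain ⟨f', h⟩ := exists_isHomogeneous_sub_mem_span hm hP hl (f.totalDegree + 1)
        (f.totalDegree + 1) d _ (homogeneousComponent_isHomogeneous d f) (by omega) (by omega)
      exact ⟨f', fun _ => h⟩
    · exact ⟨0, fun h => absurd h hd⟩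
  choose g hg using key
  refine ⟨f.totalDegree + 1, ∑ d ∈ Finset.range (f.totalDegree + 1), g d, by omega, ?_, ?_⟩
  · nth_rw 1 [← sum_homogeneousComponent f]
    rw [← Finset.sum_sub_distrib]
    exact sum_mem fun d hd => (hg d (Finset.mem_range.1 hd)).1
  · intro k hk
    rw [map_sum]
    exact Finset.sum_eq_zero fun d hd => (hg d (Finset.mem_range.1 hd)).2 k hk

/-- The joint kernel of the Hamiltonian derivations on a nonzero level of a homogeneous polynomial
that is not a proper power consists of the constants. -/
theorem exists_sub_C_mem_of_hamiltonian_mem [CharZero K]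
    {P f : MvPolynomial (Fin (N + 1)) K} {m : ℕ} (hm : m ≠ 0) (hP : P.IsHomogeneous m)
    (hP0 : P ≠ 0)
    (hp : ¬ ∃ (a : K) (c : MvPolynomial (Fin (N + 1)) K) (t : ℕ), 2 ≤ t ∧ P = C a * c ^ t)
    {l : K} (hl : l ≠ 0) (h : ∀ i j, hamiltonian P i j f ∈ Ideal.span {P - C l}) :
    ∃ a : K, f - C a ∈ Ideal.span {P - C l} := by
  obtain ⟨M, f', hM, hff', hf'⟩ := exists_sub_mem_span hm hP hl f
  have hz : ∀ i j, hamiltonian P i j f' = 0 := by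
    intro i j
    -- The window of f' shifted by m - 2; the subtraction is exact because M and m are nonzero.
    refine eq_zero_of_mem_span_of_homogeneousComponent hm hP hP0 hl (M := M + m - 2) ?_ ?_ ?_
    · have := (isPoissonIdeal_span P l).hamiltonian_mem hff' i j
      rw [map_sub] at this
      have := sub_mem (h i j) this
      rwa [sub_sub_cancel] at this
    · intro k hk
      by_cases hkm : k < m - 1
      · exact homogeneousComponent_hamiltonian_of_lt hP _ _ _ hkm
      · obtain ⟨k, rfl⟩ := Nat.exists_eq_add_of_le (not_lt.1 hkm)
        rw [homogeneousComponent_hamiltonian hP, hf' _ (by omega), map_zero]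
    · intro k hk
      obtain ⟨k, rfl⟩ := Nat.exists_eq_add_of_le (show m - 1 ≤ k by omega)
      rw [homogeneousComponent_hamiltonian hP, hf' _ (by omega), map_zero]
  have hmem := mem_adjoin_of_hamiltonian_eq_zero hm hP hP0 hp hz
  have hconst : ∀ y ∈ Algebra.adjoin K {P}, ∃ a : K, y - C a ∈ Ideal.span {P - C l} := by
    intro y hy
    induction hy using Algebra.adjoin_induction with
    | mem x hx =>
      rw [Set.mem_singleton_iff.1 hx]
      exact ⟨l, Ideal.mem_span_singleton_self _⟩
    | algebraMap r => exact ⟨r, by simp [algebraMap_eq]⟩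
    | add x y _ _ hx hy =>
      obtain ⟨a, ha⟩ := hx
      obtain ⟨b, hb⟩ := hy
      refine ⟨a + b, ?_⟩
      rw [map_add, add_sub_add_comm]
      exact add_mem ha hb
    | mul x y _ _ hx hy =>
      obtain ⟨a, ha⟩ := hx
      obtain ⟨b, hb⟩ := hy
      refine ⟨a * b, ?_⟩
      rw [map_mul, show x * y - C a * C b = x * (y - C b) + C b * (x - C a) by ring]
      exact add_mem (Ideal.mul_mem_left _ _ hb) (Ideal.mul_mem_left _ _ ha)
  obtain ⟨a, ha⟩ := hconst f' hmem
  refine ⟨a, ?_⟩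
  rw [← sub_add_sub_cancel f f' (C a)]
  exact add_mem hff' ha

theorem exists_algebraMap_eq_mk [CharZero K]
    {P f : MvPolynomial (Fin (N + 1)) K} {m : ℕ} (hm : m ≠ 0) (hP : P.IsHomogeneous m)
    (hP0 : P ≠ 0)
    (hp : ¬ ∃ (a : K) (c : MvPolynomial (Fin (N + 1)) K) (t : ℕ), 2 ≤ t ∧ P = C a * c ^ t)
    {l : K} (hl : l ≠ 0) (h : ∀ i j, hamiltonian P i j f ∈ Ideal.span {P - C l}) :
    ∃ a : K, algebraMap K (MvPolynomial (Fin (N + 1)) K ⧸ Ideal.span {P - C l}) a =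
      Ideal.Quotient.mk _ f := by
  obtain ⟨a, ha⟩ := exists_sub_C_mem_of_hamiltonian_mem hm hP hP0 hp hl h
  exact ⟨a, (Ideal.Quotient.eq.2 ha).symm⟩

theorem isCentralBracket_bracketS [CharZero K]
    {P : MvPolynomial (Fin (N + 1)) K} {m : ℕ} (hm : m ≠ 0) (hP : P.IsHomogeneous m)
    (hP0 : P ≠ 0)
    (hp : ¬ ∃ (a : K) (c : MvPolynomial (Fin (N + 1)) K) (t : ℕ), 2 ≤ t ∧ P = C a * c ^ t)
    {l : K} (hl : l ≠ 0) : IsCentralBracket (bracketS P l) := by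
  refine Set.Subset.antisymm ?_ ?_
  · intro c hc
    obtain ⟨f, rfl⟩ := Ideal.Quotient.mk_surjective c
    refine exists_algebraMap_eq_mk hm hP hP0 hp hl fun i j => ?_
    by_cases hij : i = j
    · subst hij
      simp [hamiltonian_apply]
    obtain ⟨a, k, hk, ha⟩ := exists_bracketP_eq_hamiltonian P f hij
    have := hc (fun t => Ideal.Quotient.mk _ (a t)) k (by rw [hk])
    rw [bracketS, quotientBracket_mk, Ideal.Quotient.eq_zero_iff_mem] at this
    rcases ha with ha | ha
    · rwa [← ha]
    · rwa [ha, neg_mem_iff] at this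
  · rintro _ ⟨r, rfl⟩ a i hi
    choose b hb using fun j => Ideal.Quotient.mk_surjective (a j)
    have e : a = fun j => Ideal.Quotient.mk _ (Function.update b i (C r) j) := by
      funext j
      by_cases hj : j = i
      · subst hj
        rw [hi, Function.update_self]
        rfl
      · rw [Function.update_of_ne hj, hb]
    rw [e, bracketS, quotientBracket_mk, bracketP_apply, Fin.snoc_update, jacobian_update_C,
      map_zero]

end Level

/-! ### Poisson ideals on the level are generated by idempotents -/

section Simple

open MvPolynomial

/-- If `𝔭` is a maximal ideal of an algebra of finite type over a field of characteristic zero,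
then the projection of `𝔭` to `𝔭 / 𝔭 ^ 2` extends to a derivation. -/
theorem exists_derivation_quotient_sq {K S : Type*} [Field K] [CharZero K] [CommRing S]
    [Algebra K S] [Algebra.FiniteType K S] (𝔭 : Ideal S) [h𝔭 : 𝔭.IsMaximal] :
    ∃ D : Derivation K S (S ⧸ 𝔭 ^ 2), (∀ s, D s ∈ 𝔭.cotangentIdeal) ∧
      ∀ s ∈ 𝔭, D s = Ideal.Quotient.mk (𝔭 ^ 2) s := by
  let _ : Field (S ⧸ 𝔭) := Ideal.Quotient.field 𝔭
  have : Algebra.FiniteType K (S ⧸ 𝔭) :=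
    Algebra.FiniteType.of_surjective (Ideal.Quotient.mkₐ K 𝔭) Ideal.Quotient.mk_surjective
  have hsm : Algebra.FormallySmooth K (S ⧸ 𝔭) := inferInstance
  let J := 𝔭.cotangentIdeal
  let g : (S ⧸ 𝔭) →ₐ[K] (S ⧸ 𝔭 ^ 2) ⧸ J :=
    Ideal.Quotient.liftₐ 𝔭 ((Ideal.Quotient.mkₐ K J).comp (Ideal.Quotient.mkₐ K (𝔭 ^ 2)))
      fun a ha => Ideal.Quotient.eq_zero_iff_mem.2 (Ideal.mk_mem_cotangentIdeal.2 ha)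
  -- Formal smoothness of the residue field gives a section σ across the square-zero ideal 𝔭/𝔭². The
  -- derivation is s - σ(s), the negative of the one built from the lift.
  obtain ⟨σ, hσ⟩ := Algebra.FormallySmooth.exists_lift J ⟨2, 𝔭.cotangentIdeal_square⟩ g
  let D := derivationToSquareZeroOfLift J 𝔭.cotangentIdeal_square
    (σ.comp (Ideal.Quotient.mkₐ K 𝔭)) (by
      rw [← AlgHom.comp_assoc, hσ]
      ext s
      rfl)
  refine ⟨-(J.subtype.restrictScalars S).compDer D, fun s => ?_, fun s hs => ?_⟩
  · rw [Derivation.neg_apply]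
    exact neg_mem (D s).2
  · rw [Derivation.neg_apply]
    change -(σ (Ideal.Quotient.mk 𝔭 s) - Ideal.Quotient.mk (𝔭 ^ 2) s) = _
    rw [Ideal.Quotient.eq_zero_iff_mem.2 hs, map_zero, zero_sub, neg_neg]

/-- By Leibniz, a derivation that is the identity on 𝔭/𝔭² acts on 𝔭^k/𝔭^(k+1) as multiplication by
k. -/
theorem derivation_sub_nsmul_mem_pow {K S : Type*} [CommRing K] [CommRing S] [Algebra K S]
    {𝔭 : Ideal S} (E : Derivation K S S) (h0 : ∀ s, E s ∈ 𝔭) (h1 : ∀ s ∈ 𝔭, E s - s ∈ 𝔭 ^ 2)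
    (k : ℕ) : ∀ s ∈ 𝔭 ^ k, E s - (k : S) * s ∈ 𝔭 ^ (k + 1) := by
  induction k with
  | zero => intro s _; simpa using h0 s
  | succ k ih =>
    intro s hs
    rw [pow_succ] at hs
    induction hs using Submodule.mul_induction_on' with
    | mem_mul_mem a ha b hb =>
      have e : E (a * b) - ((k + 1 : ℕ) : S) * (a * b) = a * (E b - b) + (E a - k * a) * b := by
        rw [Derivation.leibniz, smul_eq_mul, smul_eq_mul]
        push_cast
        ring
      rw [e]
      refine add_mem ?_ ?_
      · rw [show k + 1 + 1 = k + 2 from rfl, pow_add]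
        exact Ideal.mul_mem_mul ha (h1 b hb)
      · rw [pow_succ _ (k + 1)]
        exact Ideal.mul_mem_mul (ih a ha) hb
    | add x _ y _ hx hy =>
      rw [map_add, mul_add, add_sub_add_comm]
      exact add_mem hx hy

theorem le_pow_of_derivation {K S : Type*} [Field K] [CharZero K] [CommRing S] [Algebra K S]
    {𝔭 I : Ideal S} (hI : I ≤ 𝔭) (E : Derivation K S S) (h0 : ∀ s, E s ∈ 𝔭)
    (h1 : ∀ s ∈ 𝔭, E s - s ∈ 𝔭 ^ 2) (hE : ∀ s ∈ I, E s ∈ 𝔭 * I) (k : ℕ) : I ≤ 𝔭 ^ k := by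
  induction k with
  | zero => simp
  | succ k ih =>
    -- The passage from 𝔭^0 to 𝔭 is the hypothesis; the multiplier 0 could not be inverted there.
    rcases k with _ | k
    · simpa using hI
    intro s hs
    have e1 := derivation_sub_nsmul_mem_pow E h0 h1 (k + 1) s (ih hs)
    have e2 : E s ∈ 𝔭 ^ (k + 1 + 1) := by
      rw [pow_succ']
      exact Ideal.mul_mono_right ih (hE s hs)
    have e3 := sub_mem e2 e1
    rw [sub_sub_cancel] at e3
    have : s = algebraMap K S ((k + 1 : ℕ) : K)⁻¹ * (((k + 1 : ℕ) : S) * s) := by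
      rw [← mul_assoc, ← map_natCast (algebraMap K S), ← map_mul,
        inv_mul_cancel₀ (Nat.cast_ne_zero.2 k.succ_ne_zero), map_one, one_mul]
    rw [this]
    exact Ideal.mul_mem_left _ _ e3

/-- An ideal of a Noetherian ring that is contained in all powers of every maximal ideal containing
it is idempotent. -/
theorem isIdempotentElem_of_le_pow {S : Type*} [CommRing S] [IsNoetherianRing S] {I : Ideal S}
    (h : ∀ 𝔭 : Ideal S, 𝔭.IsMaximal → I ≤ 𝔭 → ∀ k, I ≤ 𝔭 ^ k) : IsIdempotentElem I := by
  refine le_antisymm Ideal.mul_le_left fun f hf => ?_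
  -- Otherwise a maximal 𝔭 contains both ideals, and Krull gives r ∈ 𝔭 with r f = f; then 1 - r
  -- annihilates f and lies in 𝔭.
  have htop : Ideal.torsionOf S S f ⊔ I = ⊤ := by
    by_contra hne
    obtain ⟨𝔭, h𝔭, hle⟩ := Ideal.exists_le_maximal _ hne
    obtain ⟨r, hr⟩ := (𝔭.mem_iInf_smul_pow_eq_bot_iff f).1 (by
      rw [Submodule.mem_iInf]
      intro k
      simpa using h 𝔭 h𝔭 (le_sup_right.trans hle) k hf)
    have h1 : 1 - (r : S) ∈ 𝔭 := by
      refine hle (Ideal.mem_sup_left ?_)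
      rw [Ideal.mem_torsionOf_iff, sub_smul, one_smul, hr, sub_self]
    exact h𝔭.ne_top ((Ideal.eq_top_iff_one _).2 (by simpa using add_mem h1 r.2))
  obtain ⟨a, ha, e, he, hae⟩ := Submodule.mem_sup.1 (htop ▸ Submodule.mem_top (x := (1 : S)))
  have : f = e * f := by
    rw [Ideal.mem_torsionOf_iff, smul_eq_mul] at ha
    linear_combination (-f) * hae + ha
  rw [this]
  exact Ideal.mul_mem_mul he hf

theorem derivation_sum_apply {K S ι : Type*} [CommRing K] [CommRing S] [Algebra K S]
    (s : Finset ι) (D : ι → Derivation K S S) (f : S) : (∑ i ∈ s, D i) f = ∑ i ∈ s, D i f := by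
  classical
  induction s using Finset.induction_on with
  | empty => simp
  | insert a s ha ih => rw [Finset.sum_insert ha, Finset.sum_insert ha, Derivation.add_apply, ih]

variable {K : Type*} [Field K] {N : ℕ}

theorem mk_hamiltonian_eq_zero (P : MvPolynomial (Fin (N + 1)) K) (l : K) (i j : Fin (N + 1))
    (f : MvPolynomial (Fin (N + 1)) K) (hf : Ideal.Quotient.mkₐ K (Ideal.span {P - C l}) f = 0) :
    Ideal.Quotient.mkₐ K (Ideal.span {P - C l}) (hamiltonian P i j f) = 0 :=
  Ideal.Quotient.eq_zero_iff_mem.2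
    ((isPoissonIdeal_span P l).hamiltonian_mem (Ideal.Quotient.eq_zero_iff_mem.1 hf) i j)

/-- The derivation induced by a Hamiltonian derivation on the level `P = l`. -/
def hamiltonianS (P : MvPolynomial (Fin (N + 1)) K) (l : K) (i j : Fin (N + 1)) :
    Derivation K (MvPolynomial (Fin (N + 1)) K ⧸ Ideal.span {P - C l})
      (MvPolynomial (Fin (N + 1)) K ⧸ Ideal.span {P - C l}) :=
  Derivation.liftOfSurjective (f := Ideal.Quotient.mkₐ K (Ideal.span {P - C l}))
    Ideal.Quotient.mk_surjective (mk_hamiltonian_eq_zero P l i j)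

theorem hamiltonianS_mk (P : MvPolynomial (Fin (N + 1)) K) (l : K) (i j : Fin (N + 1))
    (f : MvPolynomial (Fin (N + 1)) K) :
    hamiltonianS P l i j (Ideal.Quotient.mk _ f) = Ideal.Quotient.mk _ (hamiltonian P i j f) :=
  Derivation.liftOfSurjective_apply (f := Ideal.Quotient.mkₐ K (Ideal.span {P - C l}))
    Ideal.Quotient.mk_surjective (mk_hamiltonian_eq_zero P l i j) f

theorem IsPoissonIdeal.hamiltonianS_mem {P : MvPolynomial (Fin (N + 1)) K} {l : K}
    {I : Ideal (MvPolynomial (Fin (N + 1)) K ⧸ Ideal.span {P - C l})}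
    (hI : IsPoissonIdeal (bracketS P l) I)
    {f : MvPolynomial (Fin (N + 1)) K ⧸ Ideal.span {P - C l}} (hf : f ∈ I) (i j : Fin (N + 1)) :
    hamiltonianS P l i j f ∈ I := by
  obtain ⟨f, rfl⟩ := Ideal.Quotient.mk_surjective f
  rw [hamiltonianS_mk]
  have : IsPoissonIdeal (bracketP P) (I.comap (Ideal.Quotient.mk _)) := by
    intro a k hk
    have := hI (fun t => Ideal.Quotient.mk _ (a t)) k hk
    rwa [bracketS, quotientBracket_mk] at this
  exact this.hamiltonian_mem (f := f) hf i j

/-- The τᵢ lift the values at the coordinates of a derivation S → S/𝔭² extending 𝔭 → 𝔭/𝔭². The last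
clause holds because that derivation kills constants. -/
theorem exists_sum_pderiv_sub_mem_sq {σ K S : Type*} [Fintype σ] [Field K] [CharZero K]
    [CommRing S] [Algebra K S] {π : MvPolynomial σ K →ₐ[K] S} (hπ : Function.Surjective π)
    (𝔭 : Ideal S) [𝔭.IsMaximal] :
    ∃ τ : σ → S, (∀ i, τ i ∈ 𝔭) ∧
      (∀ f, π f ∈ 𝔭 → ∑ i, π (pderiv i f) * τ i - π f ∈ 𝔭 ^ 2) ∧
      ∀ f l, π f = algebraMap K S l → ∑ i, π (pderiv i f) * τ i ∈ 𝔭 ^ 2 := by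
  let _ : Algebra (MvPolynomial σ K) S := π.toRingHom.toAlgebra
  have : IsScalarTower K (MvPolynomial σ K) S :=
    IsScalarTower.of_algebraMap_eq fun r => (π.commutes r).symm
  have : Algebra.FiniteType K S := Algebra.FiniteType.of_surjective π hπ
  obtain ⟨D, hD, hD𝔭⟩ := exists_derivation_quotient_sq (K := K) 𝔭
  have hex : ∀ i, ∃ t ∈ 𝔭, Ideal.Quotient.mk (𝔭 ^ 2) t = D (π (X i)) := by
    intro i
    obtain ⟨t, ht⟩ := Ideal.Quotient.mk_surjective (D (π (X i)))
    exact ⟨t, Ideal.mk_mem_cotangentIdeal.1 (ht ▸ hD _), ht⟩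
  choose τ hτ hτD using hex
  have hDsum : ∀ f, D (π f) = Ideal.Quotient.mk (𝔭 ^ 2) (∑ i, π (pderiv i f) * τ i) := by
    intro f
    refine (derivation_eq_sum_pderiv (D.compAlgebraMap (MvPolynomial σ K)) f).trans ?_
    rw [map_sum]
    refine Finset.sum_congr rfl fun i _ => ?_
    rw [map_mul, hτD]
    exact Algebra.smul_def _ _
  refine ⟨τ, hτ, fun f hf => ?_, fun f l hf => ?_⟩
  · rw [← Ideal.Quotient.eq, ← hDsum, hD𝔭 _ hf]
  · rw [← Ideal.Quotient.eq_zero_iff_mem, ← hDsum, hf, Derivation.map_algebraMap]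

/-- On a nonzero level of a homogeneous polynomial, some combination of the Hamiltonian derivations
with coefficients in the maximal ideal `𝔭` is the identity on `𝔭 / 𝔭 ^ 2`. -/
theorem exists_derivation_sub_mem_sq {K S : Type*} [Field K] [CharZero K] {N : ℕ} [CommRing S]
    [Algebra K S] {π : MvPolynomial (Fin N) K →ₐ[K] S} (hπ : Function.Surjective π)
    {P : MvPolynomial (Fin N) K} {m : ℕ} (hm : m ≠ 0) (hP : P.IsHomogeneous m) {l : K}
    (hl : l ≠ 0) (hPl : π P = algebraMap K S l) {H : Fin N → Fin N → Derivation K S S}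
    (hH : ∀ i j f, H i j (π f) = π (hamiltonian P i j f)) (𝔭 : Ideal S) [𝔭.IsMaximal] :
    ∃ c : Fin N → Fin N → S, (∀ i j, c i j ∈ 𝔭) ∧
      ∀ s ∈ 𝔭, (∑ i, ∑ j, c i j • H i j) s - s ∈ 𝔭 ^ 2 := by
  obtain ⟨τ, hτ, hτ1, hτ2⟩ := exists_sum_pderiv_sub_mem_sq hπ 𝔭
  have hml : (m : K) * l ≠ 0 := mul_ne_zero (Nat.cast_ne_zero.2 hm) hl
  set κ : S := algebraMap K S ((m : K) * l)⁻¹ with hκ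
  have hκ1 : κ * (m * π P) = 1 := by
    rw [hPl, hκ, ← map_natCast (algebraMap K S), ← map_mul, ← map_mul, inv_mul_cancel₀ hml,
      map_one]
  -- Contracting H_ij with xⱼ produces, by Euler, ml τᵢ∂ᵢf minus a multiple of τᵢ∂ᵢP; κ inverts ml.
  -- Summed over i, the first part is f modulo 𝔭² and the second lies in 𝔭², P being constant on the
  -- level.
  refine ⟨fun i j => κ * π (X j) * τ i, fun i j => Ideal.mul_mem_left _ _ (hτ i), fun s hs => ?_⟩
  obtain ⟨f, rfl⟩ := hπ s
  have hE := congrArg π hP.sum_X_mul_pderiv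
  rw [nsmul_eq_mul, map_sum, map_mul, map_natCast] at hE
  have hW : ∀ i, ∑ j, κ * π (X j) * τ i * π (hamiltonian P i j f) =
      π (pderiv i f) * τ i - κ * π (∑ j, X j * pderiv j f) * (π (pderiv i P) * τ i) := by
    intro i
    have e : π (pderiv i f) * τ i =
        κ * (∑ j, π (X j * pderiv j P)) * (π (pderiv i f) * τ i) := by
      rw [hE, hκ1, one_mul]
    rw [e, map_sum]
    simp only [Finset.mul_sum, Finset.sum_mul]
    rw [← Finset.sum_sub_distrib]
    refine Finset.sum_congr rfl fun j _ => ?_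
    rw [hamiltonian_apply, map_sub, map_mul, map_mul, map_mul, map_mul]
    ring
  have hsum : (∑ i, ∑ j, (κ * π (X j) * τ i) • H i j) (π f) =
      (∑ i, π (pderiv i f) * τ i) -
        κ * π (∑ j, X j * pderiv j f) * ∑ i, π (pderiv i P) * τ i := by
    rw [derivation_sum_apply, Finset.mul_sum, ← Finset.sum_sub_distrib]
    refine Finset.sum_congr rfl fun i _ => ?_
    rw [← hW, derivation_sum_apply]
    refine Finset.sum_congr rfl fun j _ => ?_
    rw [Derivation.smul_apply, hH, smul_eq_mul]
  rw [hsum, sub_right_comm]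
  exact sub_mem (hτ1 f hs) (Ideal.mul_mem_left _ _ (hτ2 P l hPl))

theorem IsPoissonIdeal.isIdempotentElem [CharZero K] {P : MvPolynomial (Fin (N + 1)) K} {m : ℕ}
    (hm : m ≠ 0) (hP : P.IsHomogeneous m) {l : K} (hl : l ≠ 0)
    {I : Ideal (MvPolynomial (Fin (N + 1)) K ⧸ Ideal.span {P - C l})}
    (hI : IsPoissonIdeal (bracketS P l) I) : IsIdempotentElem I := by
  refine isIdempotentElem_of_le_pow fun 𝔭 h𝔭 hle => ?_
  obtain ⟨c, hc, hE⟩ := exists_derivation_sub_mem_sq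
    (π := Ideal.Quotient.mkₐ K (Ideal.span {P - C l})) Ideal.Quotient.mk_surjective hm hP hl
    (Ideal.Quotient.eq.2 (Ideal.mem_span_singleton_self _)) (hamiltonianS_mk P l) 𝔭
  have happ : ∀ s, (∑ i, ∑ j, c i j • hamiltonianS P l i j) s =
      ∑ i, ∑ j, c i j * hamiltonianS P l i j s := by
    intro s
    simp only [derivation_sum_apply, Derivation.smul_apply, smul_eq_mul]
  refine le_pow_of_derivation (K := K) hle (∑ i, ∑ j, c i j • hamiltonianS P l i j)
    (fun s => ?_) hE fun s hs => ?_
  · rw [happ]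
    exact sum_mem fun i _ => sum_mem fun j _ => Ideal.mul_mem_right _ _ (hc i j)
  · rw [happ]
    exact sum_mem fun i _ => sum_mem fun j _ =>
      Ideal.mul_mem_mul (hc i j) (hI.hamiltonianS_mem hs i j)

/-- From D e = 2e D e, multiplication by e gives e D e = 0. -/
theorem derivation_eq_zero_of_isIdempotentElem {K S : Type*} [CommRing K] [CommRing S]
    [Algebra K S] (D : Derivation K S S) {e : S} (he : IsIdempotentElem e) : D e = 0 := by
  have h1 : D e = e * D e + e * D e := by
    conv_lhs => rw [← he.eq]
    simp [Derivation.leibniz]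
  have h2 := congrArg (e * ·) h1
  simp only [mul_add, ← mul_assoc, he.eq] at h2
  rw [left_eq_add] at h2
  rw [h1, h2, add_zero]

theorem isSimpleBracket_bracketS [CharZero K]
    {P : MvPolynomial (Fin (N + 1)) K} {m : ℕ} (hm : m ≠ 0) (hP : P.IsHomogeneous m)
    (hconst : ∀ a : K, P ≠ C a)
    (hp : ¬ ∃ (a : K) (c : MvPolynomial (Fin (N + 1)) K) (t : ℕ), 2 ≤ t ∧ P = C a * c ^ t)
    {l : K} (hl : l ≠ 0) : IsSimpleBracket (bracketS P l) := by
  have hP0 : P ≠ 0 := fun h => hconst 0 (by rw [h, map_zero])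
  constructor
  · rw [Ideal.Quotient.nontrivial_iff, Ne, Ideal.span_singleton_eq_top]
    intro hu
    obtain ⟨a, -, ha⟩ := isUnit_iff_eq_C_of_isReduced.1 hu
    exact hconst (a + l) (by rw [map_add, ← ha, sub_add_cancel])
  · intro I hI
    obtain ⟨e, he, rfl⟩ := (I.isIdempotentElem_iff_of_fg (IsNoetherian.noetherian I)).1
      (hI.isIdempotentElem hm hP hl)
    obtain ⟨f, rfl⟩ := Ideal.Quotient.mk_surjective e
    obtain ⟨a, ha⟩ := exists_algebraMap_eq_mk hm hP hP0 hp hl (f := f) fun i j => by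
      rw [← Ideal.Quotient.eq_zero_iff_mem, ← hamiltonianS_mk]
      exact derivation_eq_zero_of_isIdempotentElem _ he
    rw [← ha]
    by_cases ha0 : a = 0
    · left
      rw [ha0, map_zero]
      exact Submodule.span_zero_singleton _
    · right
      exact Ideal.span_singleton_eq_top.2 ((isUnit_iff_ne_zero.2 ha0).map _)

end Simple

end NLiePoisson

end

theorem theorem1 {K : Type*} [Field K] [CharZero K] (n : ℕ) (hn : 2 ≤ n)
    (C : MvPolynomial (Fin (n + 1)) K) (m : ℕ) (hhom : C.IsHomogeneous m)
    (hconst : ∀ a : K, C ≠ MvPolynomial.C a) :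
    (NLiePoisson.IsClosedPolynomial C ↔
      ¬ ∃ (a : K) (c : MvPolynomial (Fin (n + 1)) K) (t : ℕ),
        2 ≤ t ∧ C = MvPolynomial.C a * c ^ t) ∧
    (NLiePoisson.IsClosedPolynomial C → ∀ l : K, l ≠ 0 →
      NLiePoisson.IsNLiePoisson (NLiePoisson.bracketS C l) ∧
      NLiePoisson.IsSimpleBracket (NLiePoisson.bracketS C l) ∧
      NLiePoisson.IsCentralBracket (NLiePoisson.bracketS C l)) := by
  have hm : m ≠ 0 := by
    rintro rfl
    exact hconst _ (NLiePoisson.eq_C_of_isHomogeneous_zero hhom)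
  have hC0 : C ≠ 0 := fun h => hconst 0 (by rw [h, map_zero])
  have hiff := NLiePoisson.isClosedPolynomial_iff hm hhom hC0
  refine ⟨hiff, fun hcl l hl => ⟨?_, ?_, ?_⟩⟩
  · exact (NLiePoisson.isNLiePoisson_bracketP C).quotient _ _
  · exact NLiePoisson.isSimpleBracket_bracketS hm hhom hconst (hiff.1 hcl) hl
  · exact NLiePoisson.isCentralBracket_bracketS hm hhom hC0 (hiff.1 hcl) hl
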